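/- All graphs are simple; a clique is a graph (possibly empty) in which every two distinct vertices are adjacent. A graph is a non-trivial join if it is obtained from two vertex-disjoint graphs, neither of which is a clique, by joining every vertex of the first with every vertex of the second. A Charney--Sultan graph is a finite connected graph that is the union of two distinct proper induced subgraphs $C$ and $J$, where $C$ is a cycle of length at least $5$ and $J$ is a non-trivial join. Let $\mathcal C$ be the smallest class of finite graphs that contains all finite graphs without edges, all finite trees, all Charney--Sultan graphs, all finite cliques and all finite non-trivial joins, and that contains $\Lambda_1\cup\Lambda_2$ whenever $\Lambda_1,\Lambda_2\in\mathcal C$, the graph $\Lambda_1\cap\Lambda_2$ is an induced subgraph of $\Lambda_1\cup\Lambda_2$, and $\Lambda_1\cap\Lambda_2$ is empty, or a clique, or contained in a non-trivial join of two induced subgraphs of $\Lambda_1\cup\Lambda_2$. The four-cycle graph $\Gamma^4$ of a graph $\Gamma$ has the induced $4$-cycles of $\Gamma$ as vertices, two of them being adjacent if they share a pair of vertices that are non-adjacent in $\Gamma$. The support of a subgraph of $\Gamma^4$ is the set of vertices of $\Gamma$ lying on one of the corresponding $4$-cycles. A graph $\Delta$ is $\mathcal{CFS}$ if it is the join of a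 non-empty graph $\Gamma$ and a (possibly empty) clique such that $\Gamma^4$ has a connected component whose support is the whole vertex set of $\Gamma$. Let $\mathcal{CFS}_0$ be the class of finite graphs with at least $5$ vertices that are $\mathcal{CFS}$, connected, triangle-free and planar (that is, they can be drawn in the Euclidean plane without crossings, the edges being drawn as polygonal curves), and that have no separating vertex and no separating edge, where a vertex (respectively an edge) is separating if deleting it (respectively deleting it together with both of its endpoints) disconnects the graph. **Proposition.** $\mathcal{CFS}_0\subseteq\mathcal C$. -/

import Mathlib

universe u

namespace RACGraph

/-- The graph `G` is a non-trivial join: its vertex set is the disjoint union of two sets `A` and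
`B`, every vertex of `A` is adjacent to every vertex of `B`, and neither of the subgraphs spanned by
`A` and `B` is a clique. -/
def IsNontrivialJoin {V : Type u} (G : SimpleGraph V) : Prop :=
  ∃ A B : Set V, Disjoint A B ∧ A ∪ B = Set.univ ∧ (∀ a ∈ A, ∀ b ∈ B, G.Adj a b) ∧
    ¬ G.IsClique A ∧ ¬ G.IsClique B

/-- A Charney-Sultan graph: a finite connected graph that is the union of two distinct proper
induced subgraphs `C` and `J`, where `C` is a cycle of length at least five and `J` is a
non-trivial join (of two graphs, which are then induced subgraphs of `G`). -/
def IsCharneySultan {V : Type u} (G : SimpleGraph V) : Prop :=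
  Finite V ∧ G.Connected ∧
    ∃ C J : G.Subgraph, C ≠ J ∧ C ≠ ⊤ ∧ J ≠ ⊤ ∧ C.IsInduced ∧ J.IsInduced ∧ C ⊔ J = ⊤ ∧
      (∃ n : ℕ, 5 ≤ n ∧ Nonempty (C.coe ≃g SimpleGraph.cycleGraph n)) ∧
      IsNontrivialJoin J.coe

/-- The class `𝒞` of clique-square-decomposable graphs: the smallest class of finite graphs that
contains the edgeless graphs, the trees, the Charney-Sultan graphs, the cliques and the non-trivial
joins, and that contains the union `G` of any two of its members `Λ₁`, `Λ₂` whose intersection is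
an induced subgraph of `G` and is empty, or a clique, or contained in a non-trivial join of two
induced subgraphs of `G`. -/
inductive CliqueSquareDecomposable : ∀ {V : Type u}, SimpleGraph V → Prop
  | edgeless {V : Type u} (G : SimpleGraph V) (hfin : Finite V) (h : G = ⊥) :
      CliqueSquareDecomposable G
  | tree {V : Type u} (G : SimpleGraph V) (hfin : Finite V) (h : G.IsTree) :
      CliqueSquareDecomposable G
  | charneySultan {V : Type u} (G : SimpleGraph V) (h : IsCharneySultan G) :
      CliqueSquareDecomposable G
  | clique {V : Type u} (G : SimpleGraph V) (hfin : Finite V) (h : G = ⊤) :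
      CliqueSquareDecomposable G
  | join {V : Type u} (G : SimpleGraph V) (hfin : Finite V) (h : IsNontrivialJoin G) :
      CliqueSquareDecomposable G
  | union {V : Type u} (G : SimpleGraph V) (Λ₁ Λ₂ : G.Subgraph) (hunion : Λ₁ ⊔ Λ₂ = ⊤)
      (h₁ : CliqueSquareDecomposable Λ₁.coe) (h₂ : CliqueSquareDecomposable Λ₂.coe)
      (hind : (Λ₁ ⊓ Λ₂).IsInduced)
      (hcond : (Λ₁ ⊓ Λ₂).verts = ∅ ∨ G.IsClique (Λ₁ ⊓ Λ₂).verts ∨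
        ∃ J : Set V, (Λ₁ ⊓ Λ₂).verts ⊆ J ∧ IsNontrivialJoin (G.induce J)) :
      CliqueSquareDecomposable G

/-- The vertex set `s` spans an induced cycle of length four in `G`. Induced four-cycles correspond
bijectively to their vertex sets. -/
def IsInducedFourCycle {V : Type u} (G : SimpleGraph V) (s : Set V) : Prop :=
  ∃ a b c d : V, s = {a, b, c, d} ∧ a ≠ c ∧ b ≠ d ∧
    G.Adj a b ∧ G.Adj b c ∧ G.Adj c d ∧ G.Adj d a ∧ ¬ G.Adj a c ∧ ¬ G.Adj b d

/-- The four-cycle graph of `G`: its vertices are the induced four-cycles of `G`, and two of them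
are adjacent if they have a pair of non-adjacent vertices of `G` in common. -/
def fourCycleGraph {V : Type u} (G : SimpleGraph V) :
    SimpleGraph {s : Set V // IsInducedFourCycle G s} where
  Adj s t := s ≠ t ∧ ∃ x y : V, x ≠ y ∧ ¬ G.Adj x y ∧ x ∈ s.1 ∧ y ∈ s.1 ∧ x ∈ t.1 ∧ y ∈ t.1
  symm := ⟨by
    rintro s t ⟨hne, x, y, hxy, hadj, hxs, hys, hxt, hyt⟩
    exact ⟨hne.symm, x, y, hxy, hadj, hxt, hyt, hxs, hys⟩⟩
  loopless := ⟨fun _ h => h.1 rfl⟩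

/-- The four-cycle graph of `G` has a connected component whose support, that is, the set of
vertices of `G` lying on the four-cycles of the component, is the whole vertex set of `G`. -/
def HasFullFourCycleComponent {V : Type u} (G : SimpleGraph V) : Prop :=
  ∃ c : (fourCycleGraph G).ConnectedComponent, {v : V | ∃ s ∈ c.supp, v ∈ s.1} = Set.univ

/-- `G` is `𝒞ℱ𝒮`: it is the join of a non-empty subgraph (spanned by `A`) and a possibly empty
clique (spanned by `K`) such that the four-cycle graph of the former has a connected component with
full support. -/
def IsCFS {V : Type u} (G : SimpleGraph V) : Prop :=
  ∃ A K : Set V, Disjoint A K ∧ A ∪ K = Set.univ ∧ (∀ a ∈ A, ∀ k ∈ K, G.Adj a k) ∧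
    A.Nonempty ∧ G.IsClique K ∧ HasFullFourCycleComponent (G.induce A)

/-- `S` is the image of a polygonal curve in the plane that starts at `a` and ends at `b`. -/
def IsPolygonalCurve (a b : EuclideanSpace ℝ (Fin 2)) (S : Set (EuclideanSpace ℝ (Fin 2))) :
    Prop :=
  ∃ (n : ℕ) (p : ℕ → EuclideanSpace ℝ (Fin 2)), p 0 = a ∧ p n = b ∧
    S = ⋃ i ∈ Finset.range n, segment ℝ (p i) (p (i + 1))

/-- A planar embedding of `G`, that is, a drawing without crossings: distinct vertices are drawn as
distinct points of the plane, an edge is drawn as a polygonal curve that joins its endpoints and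
avoids the other vertices, and distinct edges meet in common endpoints only. (A curve may revisit
one of its own points; cutting off such loops gives an embedding by simple curves.) -/
structure PlanarEmbedding {V : Type u} (G : SimpleGraph V) where
  point : V → EuclideanSpace ℝ (Fin 2)
  point_injective : Function.Injective point
  curve : Sym2 V → Set (EuclideanSpace ℝ (Fin 2))
  curve_polygonal : ∀ u v : V, G.Adj u v → IsPolygonalCurve (point u) (point v) (curve s(u, v))
  mem_of_point_mem : ∀ e ∈ G.edgeSet, ∀ w : V, point w ∈ curve e → w ∈ e
  inter_curve : ∀ e ∈ G.edgeSet, ∀ e' ∈ G.edgeSet, e ≠ e' → ∀ p ∈ curve e ∩ curve e',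
    ∃ w : V, w ∈ e ∧ w ∈ e' ∧ p = point w

/-- `G` is planar: it has a planar embedding. -/
def IsPlanar {V : Type u} (G : SimpleGraph V) : Prop :=
  Nonempty (PlanarEmbedding G)

/-- Deleting the vertices in `S`, with all incident edges, disconnects the graph. -/
def Separates {V : Type u} (G : SimpleGraph V) (S : Set V) : Prop :=
  ¬ (G.induce Sᶜ).Preconnected

/-- The class `𝒞ℱ𝒮₀`. A separating edge is an edge whose deletion together with both of its
endpoints disconnects the graph. -/
structure IsCFSZero {V : Type u} (G : SimpleGraph V) : Prop where
  finite : Finite V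
  cfs : IsCFS G
  connected : G.Connected
  triangleFree : G.CliqueFree 3
  planar : IsPlanar G
  five_le_card : 5 ≤ Nat.card V
  no_separating_vertex : ∀ v : V, ¬ Separates G {v}
  no_separating_edge : ∀ u v : V, G.Adj u v → ¬ Separates G {u, v}

end RACGraph

/-! The graph is shown to arise from non-trivial joins by gluing along squares (four-cycles), by
induction on the number of vertices. Triangle-freeness makes every four-cycle induced and rules out
clique vertices in the `𝒞ℱ𝒮` decomposition. So the hypothesis becomes: from some pair of opposite
vertices of a square, repeated passage to the other diagonal of a square reaches pairs covering all
vertices (`IsFullDiagonal`).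

Suppose a reachable diagonal `{x, y}` has a set `N` of at least three common neighbours. If `{x, y}
∪ N` is everything, the graph is a join. Otherwise take a component `C` of the complement. It has at
most two neighbours in `N`, since contracting `C` would otherwise give a `K₃,₃`
(`IsPlanar.not_attached`). Hence a square `Q = {x, y, m, n}` with `m, n ∈ N` separates `C` from the
rest. Both `C ∪ Q` and the complement of `C` are smaller and still have a full diagonal
(`IsFullDiagonal.induce`), and they meet in the join `Q`. If no reachable diagonal has three common
neighbours, the passage never leaves one square, which is then the whole graph.

Non-planarity of `K₃,₃` is proved by a parity count of winding numbers
(`not_exists_paths_three_three`). -/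

namespace RACGraph

/-! ### Continuous logarithms and the non-planarity of `K₃,₃`. -/

open Complex

/-- The change of a continuous branch of `log (γ - p)` between the parameters `0` and `1`. -/
noncomputable def logChange (γ : ℝ → ℂ) (p : ℂ) : ℂ :=
  open Classical in
  if h : ∃ L : ℝ → ℂ, Continuous L ∧ ∀ t, exp (L t) = γ t - p then
    h.choose 1 - h.choose 0 else 0

/-- Two branches differ by a continuous function with values in the discrete set `2πiℤ`, which is
constant because `ℝ` is connected. -/
theorem sub_eq_sub_of_exp_eq {L M : ℝ → ℂ} (hL : Continuous L) (hM : Continuous M)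
    (h : ∀ t, exp (L t) = exp (M t)) : L 1 - L 0 = M 1 - M 0 := by
  have key : ∀ t, ∃ n : ℤ, L t - M t = n * (2 * Real.pi * I) := fun t => by
    obtain ⟨n, hn⟩ := exp_eq_exp_iff_exists_int.1 (h t)
    exact ⟨n, by rw [hn]; ring⟩
  choose n hn using key
  have hpi : (2 * Real.pi * I : ℂ) ≠ 0 := two_pi_I_ne_zero
  have hcont : Continuous fun t => (n t : ℂ) := by
    have : (fun t => (n t : ℂ)) = fun t => (L t - M t) / (2 * Real.pi * I) := by
      funext t
      rw [hn t, mul_div_cancel_right₀ _ hpi]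
    rw [this]
    fun_prop
  have hcont' : Continuous n := by
    have := Complex.continuous_re.comp hcont
    have h2 : Continuous fun t => ((n t : ℤ) : ℝ) := by simpa [Function.comp_def] using this
    exact Int.isClosedEmbedding_coe_real.isEmbedding.continuous_iff.2 h2
  have h01 : n 1 = n 0 := PreconnectedSpace.constant inferInstance hcont'
  have h1 := hn 1
  have h0 := hn 0
  rw [h01] at h1
  linear_combination h1 - h0

theorem logChange_eq {γ : ℝ → ℂ} {p : ℂ} {L : ℝ → ℂ} (hL : Continuous L)
    (h : ∀ t, exp (L t) = γ t - p) : logChange γ p = L 1 - L 0 := by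
  have hex : ∃ L : ℝ → ℂ, Continuous L ∧ ∀ t, exp (L t) = γ t - p := ⟨L, hL, h⟩
  rw [logChange, dif_pos hex]
  exact sub_eq_sub_of_exp_eq hex.choose_spec.1 hL fun t => by rw [hex.choose_spec.2, h]

/-- The exponential is a covering of the punctured plane, and the simply connected `ℝ × ℝ` admits
lifts. -/
theorem exists_continuous_log (F : C(ℝ × ℝ, ℂ)) (hF : ∀ a, F a ≠ 0) :
    ∃ L : C(ℝ × ℝ, ℂ), ∀ a, exp (L a) = F a := by
  obtain ⟨L, ⟨-, hL⟩, -⟩ := isCoveringMapOn_exp.existsUnique_continuousMap_lifts F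
    (a₀ := (0, 0)) (exp_log (hF _)) (fun a => hF a)
  exact ⟨L, fun a => congrFun hL a⟩

/-- Disjointness makes `f t - e s` nowhere zero, so it has a logarithm on the whole parameter plane,
whose total change around the unit square vanishes. -/
theorem logChange_rectangle {e f : ℝ → ℂ} (he : Continuous e) (hf : Continuous f)
    (hef : ∀ s t, e s ≠ f t) :
    logChange f (e 0) + logChange e (f 1) - logChange f (e 1) - logChange e (f 0) = 0 := by
  obtain ⟨L, hL⟩ := exists_continuous_log ⟨fun a : ℝ × ℝ => f a.2 - e a.1, by fun_prop⟩
    fun a => sub_ne_zero.2 (hef a.1 a.2).symm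
  have hrow (s : ℝ) : logChange f (e s) = L (s, 1) - L (s, 0) :=
    logChange_eq (L := fun t => L (s, t)) (by fun_prop) fun t => hL (s, t)
  have hcol (t : ℝ) : logChange e (f t) = L (1, t) - L (0, t) := by
    -- Along the other sides the relevant difference is `e s - f t`, of opposite sign; the shift by
    -- `πi` cancels in the change.
    rw [logChange_eq (L := fun s => L (s, t) + Real.pi * I) (by fun_prop) fun s => ?_]
    · ring
    · rw [exp_add, exp_pi_mul_I, hL]
      simp
  rw [hrow, hrow, hcol, hcol]
  ring

theorem exists_int_logChange {γ : ℝ → ℂ} {p : ℂ} (hγ : Continuous γ) (hp : ∀ t, γ t ≠ p) :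
    ∃ k : ℤ, logChange γ p = log (γ 1 - p) - log (γ 0 - p) + k * (2 * Real.pi * I) := by
  obtain ⟨L, hL⟩ := exists_continuous_log ⟨fun a : ℝ × ℝ => γ a.2 - p, by fun_prop⟩
    fun a => sub_ne_zero.2 (hp a.2)
  have h := logChange_eq (γ := γ) (p := p) (L := fun t => L (0, t)) (by fun_prop)
    fun t => hL (0, t)
  have hend (t : ℝ) : ∃ n : ℤ, L (0, t) = log (γ t - p) + n * (2 * Real.pi * I) :=
    exp_eq_exp_iff_exists_int.1 (by rw [hL, exp_log (sub_ne_zero.2 (hp t))]; rfl)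
  obtain ⟨n, hn⟩ := hend 1
  obtain ⟨m, hm⟩ := hend 0
  refine ⟨n - m, ?_⟩
  rw [h, hn, hm]
  push_cast
  ring

theorem exists_odd_log_sub (p q : ℂ) (h : p ≠ q) :
    ∃ m : ℤ, log (p - q) - log (q - p) = (2 * m + 1) * (Real.pi * I) := by
  have : exp (log (p - q)) = exp (log (q - p) + Real.pi * I) := by
    rw [exp_add, exp_log (sub_ne_zero.2 h), exp_log (sub_ne_zero.2 h.symm), exp_pi_mul_I]
    ring
  obtain ⟨m, hm⟩ := exp_eq_exp_iff_exists_int.1 this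
  exact ⟨m, by rw [hm]; ring⟩

/-- The complete bipartite graph `K₃,₃` cannot be mapped to the plane such that disjoint edges
have disjoint images. -/
theorem not_exists_paths_three_three (x y : Fin 3 → ℂ) (γ : ∀ i j, Path (x i) (y j))
    (hγ : ∀ i i' j j', i ≠ i' → j ≠ j' → ∀ s t, γ i j s ≠ γ i' j' t) : False := by
  -- Extending the paths constantly beyond `[0, 1]` keeps the images, hence their disjointness.
  let g (i j : Fin 3) : ℝ → ℂ := (γ i j).extend
  have hg (i j) : Continuous (g i j) := (γ i j).continuous_extend
  have g0 (i j) : g i j 0 = x i := (γ i j).extend_zero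
  have g1 (i j) : g i j 1 = y j := (γ i j).extend_one
  have hdisj {i i' j j'} (hi : i ≠ i') (hj : j ≠ j') (s t) : g i j s ≠ g i' j' t := by
    exact hγ i i' j j' hi hj _ _
  have other : ∀ i : Fin 3, ∃ j, i ≠ j := by decide
  have hx {i i'} (hi : i ≠ i') (j t) : g i' j t ≠ x i := by
    obtain ⟨j', hj⟩ := other j
    rw [← g0 i j']
    exact hdisj hi.symm hj t 0
  have hy {j j'} (hj : j ≠ j') (i t) : g i j' t ≠ y j := by
    obtain ⟨i', hi⟩ := other i
    rw [← g1 i' j]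
    exact hdisj hi hj.symm t 1
  have hxx {i i'} (hi : i ≠ i') : x i ≠ x i' := by
    rw [← g0 i 0]; exact hx hi.symm _ _
  have hyy {j j'} (hj : j ≠ j') : y j ≠ y j' := by
    rw [← g1 0 j]; exact hy hj.symm _ _
  have hxy (i j) : x i ≠ y j := by
    obtain ⟨j', hj⟩ := other j
    rw [← g0 i j']; exact hy hj _ _
  have ekx (a i j : Fin 3) : ∃ k : ℤ, a ≠ i → logChange (g i j) (x a) =
      log (y j - x a) - log (x i - x a) + k * (2 * Real.pi * I) := by
    -- The value `0` in the excluded case is a dummy that lets `choose` produce a total function;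
    -- the same device recurs below.
    by_cases h : a = i
    · exact ⟨0, fun h' => absurd h h'⟩
    · obtain ⟨k, hk⟩ := exists_int_logChange (hg i j) (hx h j)
      exact ⟨k, fun _ => by rw [hk, g0, g1]⟩
  have eky (b i j : Fin 3) : ∃ k : ℤ, b ≠ j → logChange (g i j) (y b) =
      log (y j - y b) - log (x i - y b) + k * (2 * Real.pi * I) := by
    by_cases h : b = j
    · exact ⟨0, fun h' => absurd h h'⟩
    · obtain ⟨k, hk⟩ := exists_int_logChange (hg i j) (hy h i)
      exact ⟨k, fun _ => by rw [hk, g0, g1]⟩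
  choose kx hkx using ekx
  choose ky hky using eky
  have exx (i i' : Fin 3) : ∃ m : ℤ, i ≠ i' →
      log (x i - x i') - log (x i' - x i) = (2 * m + 1) * (Real.pi * I) := by
    by_cases h : i = i'
    · exact ⟨0, fun h' => absurd h h'⟩
    · obtain ⟨m, hm⟩ := exists_odd_log_sub _ _ (hxx h)
      exact ⟨m, fun _ => hm⟩
  have eyy (i i' : Fin 3) : ∃ m : ℤ, i ≠ i' →
      log (y i - y i') - log (y i' - y i) = (2 * m + 1) * (Real.pi * I) := by
    by_cases h : i = i'
    · exact ⟨0, fun h' => absurd h h'⟩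
    · obtain ⟨m, hm⟩ := exists_odd_log_sub _ _ (hyy h)
      exact ⟨m, fun _ => hm⟩
  have exy (i j : Fin 3) : ∃ m : ℤ,
      log (x i - y j) - log (y j - x i) = (2 * m + 1) * (Real.pi * I) :=
    exists_odd_log_sub _ _ (hxy i j)
  choose mx hmx using exx
  choose my hmy using eyy
  choose mxy hmxy using exy
  have hmy' {j j'} (hj : j ≠ j') : my j j' + my j' j + 1 = 0 := by
    have h : ((my j j' + my j' j + 1 : ℤ) : ℂ) * (2 * (Real.pi * I)) = 0 := by
      push_cast
      linear_combination - hmy j j' hj - hmy j' j hj.symm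
    exact_mod_cast (mul_eq_zero.1 h).resolve_right (by simp)
  have main {i i' j j'} (hi : i ≠ i') (hj : j ≠ j') :
      kx i i' j' + ky j' i j - ky j i' j' - kx i' i j + mx i i' + my j j' + 1
        - mxy i j' + mxy i' j = 0 := by
    have h := logChange_rectangle (hg i j) (hg i' j') (hdisj hi hj)
    rw [g0, g1, g0, g1, hkx _ _ _ hi, hky _ _ _ hj.symm, hky _ _ _ hj, hkx _ _ _ hi.symm] at h
    have h' : ((kx i i' j' + ky j' i j - ky j i' j' - kx i' i j + mx i i' + my j j' + 1
        - mxy i j' + mxy i' j : ℤ) : ℂ) * (2 * (Real.pi * I)) = 0 := by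
      push_cast
      linear_combination h - hmx i i' hi - hmy j j' hj + hmxy i j' - hmxy i' j
    exact_mod_cast (mul_eq_zero.1 h').resolve_right (by simp)
  have h01 : (0 : Fin 3) ≠ 1 := by decide
  have h02 : (0 : Fin 3) ≠ 2 := by decide
  have h12 : (1 : Fin 3) ≠ 2 := by decide
  have y01 := hmy' h01
  have y02 := hmy' h02
  have y12 := hmy' h12
  have row {i i'} (hi : i ≠ i') := And.intro (main hi h01) <| And.intro (main hi h01.symm) <|
    And.intro (main hi h02) <| And.intro (main hi h02.symm) <|
    And.intro (main hi h12) (main hi h12.symm)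
  have r1 := row h01
  have r2 := row h02
  have r3 := row h12
  -- Add the 18 equations for `i < i'` and `j ≠ j'` modulo 2. All `kx`, `ky`, `mx`, `mxy` and the
  -- constants `1` occur an even number of times. The `my` terms contribute three times the sum of
  -- three pairs, each equal to `-1`, that is `-9`, which is odd.
  omega

/-! ### Planar drawings and contraction of a connected set. -/

theorem IsPolygonalCurve.joinedIn {a b : EuclideanSpace ℝ (Fin 2)}
    {S : Set (EuclideanSpace ℝ (Fin 2))} (h : IsPolygonalCurve a b S) (hab : a ≠ b) :
    JoinedIn S a b := by
  obtain ⟨n, p, rfl, rfl, rfl⟩ := h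
  -- For `n = 0` the union of segments is empty and contains no endpoint; distinct endpoints exclude
  -- this.
  have hn : 0 < n := Nat.pos_of_ne_zero fun h => hab (by rw [h])
  have hseg (i : ℕ) (hi : i < n) :
      segment ℝ (p i) (p (i + 1)) ⊆ ⋃ i ∈ Finset.range n, segment ℝ (p i) (p (i + 1)) :=
    Set.subset_biUnion_of_mem (u := fun i => segment ℝ (p i) (p (i + 1)))
      (Finset.mem_coe.2 (Finset.mem_range.2 hi))
  have key : ∀ m ≤ n,
      JoinedIn (⋃ i ∈ Finset.range n, segment ℝ (p i) (p (i + 1))) (p 0) (p m) := by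
    intro m
    induction m with
    | zero => exact fun _ => JoinedIn.refl (hseg 0 hn (left_mem_segment ℝ _ _))
    | succ m ih =>
      intro hm
      exact (ih (by omega)).trans ((JoinedIn.of_segment_subset subset_rfl).mono (hseg m hm))
  exact key n le_rfl

/-- A graph that embeds into a planar graph is planar. -/
theorem IsPlanar.of_embedding {V W : Type*} {G : SimpleGraph V} {H : SimpleGraph W}
    (hG : IsPlanar G) (φ : H ↪g G) : IsPlanar H := by
  obtain ⟨P⟩ := hG
  have hmem {e : Sym2 W} (he : e ∈ H.edgeSet) : e.map φ ∈ G.edgeSet := by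
    induction e with
    | h a b => simpa using he
  exact ⟨{
    point := P.point ∘ φ
    point_injective := P.point_injective.comp φ.injective
    curve := fun e => P.curve (e.map φ)
    curve_polygonal := fun u v h => P.curve_polygonal _ _ (φ.map_adj_iff.2 h)
    mem_of_point_mem := fun e he w hw => by
      obtain ⟨v, hv, hvw⟩ := Sym2.mem_map.1 (P.mem_of_point_mem _ (hmem he) _ hw)
      rwa [← φ.injective hvw]
    inter_curve := fun e he e' he' hne p hp => by
      obtain ⟨w, hw, hw', rfl⟩ := P.inter_curve _ (hmem he) _ (hmem he')
        (fun h => hne (Sym2.map.injective φ.injective h)) p hp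
      obtain ⟨v, hv, rfl⟩ := Sym2.mem_map.1 hw
      obtain ⟨v', hv', h⟩ := Sym2.mem_map.1 hw'
      rw [φ.injective h] at hv'
      exact ⟨v, hv, hv', rfl⟩ }⟩

/-- The part of a planar drawing that consists of the edges spanned by a set of vertices. -/
def PlanarEmbedding.drawing {V : Type*} {G : SimpleGraph V} (P : PlanarEmbedding G) (S : Set V) :
    Set (EuclideanSpace ℝ (Fin 2)) :=
  ⋃ e ∈ {e ∈ G.edgeSet | ∀ v ∈ e, v ∈ S}, P.curve e

theorem PlanarEmbedding.joinedIn_drawing {V : Type*} {G : SimpleGraph V} (P : PlanarEmbedding G)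
    {S : Set V} {u v : V} (h : G.Adj u v) (hu : u ∈ S) (hv : v ∈ S) :
    JoinedIn (P.drawing S) (P.point u) (P.point v) := by
  refine ((P.curve_polygonal u v h).joinedIn (P.point_injective.ne h.ne)).mono ?_
  refine Set.subset_biUnion_of_mem (u := P.curve) ⟨h, fun w hw => ?_⟩
  rcases Sym2.mem_iff.1 hw with rfl | rfl <;> assumption

theorem PlanarEmbedding.disjoint_drawing {V : Type*} {G : SimpleGraph V} (P : PlanarEmbedding G)
    {S T : Set V} (h : Disjoint S T) : Disjoint (P.drawing S) (P.drawing T) := by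
  refine Set.disjoint_left.2 fun p hp hp' => ?_
  obtain ⟨e, ⟨he, heS⟩, hpe⟩ := Set.mem_iUnion₂.1 hp
  obtain ⟨f, ⟨hf, hfT⟩, hpf⟩ := Set.mem_iUnion₂.1 hp'
  by_cases hef : e = f
  · subst hef
    induction e with
    | h a b =>
      exact Set.disjoint_left.1 h (heS a (Sym2.mem_mk_left _ _)) (hfT a (Sym2.mem_mk_left _ _))
  · obtain ⟨w, hw, hw', -⟩ := P.inter_curve e he f hf hef p ⟨hpe, hpf⟩
    exact Set.disjoint_left.1 h (heS w hw) (hfT w hw')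

/-- The standard identification of the Euclidean plane with the complex numbers. -/
noncomputable def planeToComplex (p : EuclideanSpace ℝ (Fin 2)) : ℂ := p 0 + p 1 * Complex.I

theorem planeToComplex_injective : Function.Injective planeToComplex := by
  intro p q h
  have hre := congrArg Complex.re h
  have him := congrArg Complex.im h
  simp [planeToComplex] at hre him
  ext i
  fin_cases i <;> assumption

theorem continuous_planeToComplex : Continuous planeToComplex := by
  unfold planeToComplex
  fun_prop

/-- In a planar graph, a connected set of vertices cannot be attached to three common neighbours
of two vertices outside of it. -/
theorem IsPlanar.not_attached {V : Type*} {G : SimpleGraph V} (hG : IsPlanar G) {x y : V}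
    (hxy : x ≠ y) {n : Fin 3 → V} (hn : Function.Injective n) (hx : ∀ j, G.Adj x (n j))
    (hy : ∀ j, G.Adj y (n j)) {C : Set V} {c : V}
    (hC : ∀ v ∈ C, Relation.ReflTransGen (fun a b => G.Adj a b ∧ a ∈ C ∧ b ∈ C) c v)
    (hxC : x ∉ C) (hyC : y ∉ C) (hnC : ∀ j, n j ∉ C) (hatt : ∀ j, ∃ v ∈ C, G.Adj v (n j)) :
    False := by
  obtain ⟨P⟩ := hG
  -- These sets are the three branch sets of a `K₃,₃` minor, with the `n j` on the other side; `C`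
  -- is represented by `c`, and paths from `c` stay in the drawing of `C` together with `n j`.
  let S : Fin 3 → Set V := ![{x}, {y}, C]
  have hS {i i' : Fin 3} (hi : i ≠ i') : Disjoint (S i) (S i') := by
    fin_cases i <;> fin_cases i' <;> first | exact absurd rfl hi | simp [S, hxC, hyC, hxy, hxy.symm]
  have hnS (i j : Fin 3) : n j ∉ S i := by
    fin_cases i
    exacts [(hx j).ne', (hy j).ne', hnC j]
  have hpath (i j : Fin 3) : JoinedIn (P.drawing (insert (n j) (S i))) (P.point (![x, y, c] i))
      (P.point (n j)) := by
    fin_cases i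
    · exact P.joinedIn_drawing (hx j) (by simp [S]) (by simp)
    · exact P.joinedIn_drawing (hy j) (by simp [S]) (by simp)
    · obtain ⟨v, hv, hvn⟩ := hatt j
      have := hC v hv
      clear hC
      induction this using Relation.ReflTransGen.head_induction_on with
      | refl => exact P.joinedIn_drawing hvn (Set.mem_insert_of_mem _ hv) (Set.mem_insert _ _)
      | head h _ ih =>
        exact (P.joinedIn_drawing h.1 (Set.mem_insert_of_mem _ h.2.1)
          (Set.mem_insert_of_mem _ h.2.2)).trans ih
  refine not_exists_paths_three_three (fun i => planeToComplex (P.point (![x, y, c] i)))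
    (fun j => planeToComplex (P.point (n j)))
    (fun i j => (hpath i j).somePath.map continuous_planeToComplex) ?_
  intro i i' j j' hi hj s t h
  have hd : Disjoint (insert (n j) (S i)) (insert (n j') (S i')) := by
    rw [Set.disjoint_insert_left, Set.disjoint_insert_right]
    refine ⟨?_, hnS i j', hS hi⟩
    rintro (h | h)
    exacts [hj (hn h), hnS i' j h]
  have hst := planeToComplex_injective h
  refine Set.disjoint_left.1 (P.disjoint_drawing hd) ((hpath i j).somePath_mem s) ?_
  have := (hpath i' j').somePath_mem t
  exact hst ▸ this

/-! ### Diagonals of squares in place of the four-cycle graph. -/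

/-- The pairs `p` and `q` are the two diagonals of a four-cycle of `G`. -/
def CrossingDiagonals {V : Type*} (G : SimpleGraph V) (p q : V × V) : Prop :=
  p.1 ≠ p.2 ∧ q.1 ≠ q.2 ∧ G.Adj p.1 q.1 ∧ G.Adj p.1 q.2 ∧ G.Adj p.2 q.1 ∧ G.Adj p.2 q.2

/-- Two pairs of vertices are connected by a sequence of crossing diagonals. -/
abbrev DiagonalReachable {V : Type*} (G : SimpleGraph V) : V × V → V × V → Prop :=
  Relation.ReflTransGen (CrossingDiagonals G)

/-- The pair `p` is a diagonal of a four-cycle, and the diagonals connected with it cover all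
vertices. -/
def IsFullDiagonal {V : Type*} (G : SimpleGraph V) (p : V × V) : Prop :=
  (∃ q, CrossingDiagonals G p q) ∧ ∀ v, ∃ w, DiagonalReachable G p (v, w)

section

variable {V : Type*} {G : SimpleGraph V}

theorem not_adj_of_triangleFree (hG : G.CliqueFree 3) {a b c : V} (ha : G.Adj a c)
    (hb : G.Adj b c) : ¬ G.Adj a b := fun h => by
  classical
  exact hG {a, b, c} (SimpleGraph.is3Clique_triple_iff.2 ⟨h, ha, hb⟩)

theorem CrossingDiagonals.symm {p q : V × V} (h : CrossingDiagonals G p q) :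
    CrossingDiagonals G q p :=
  ⟨h.2.1, h.1, h.2.2.1.symm, h.2.2.2.2.1.symm, h.2.2.2.1.symm, h.2.2.2.2.2.symm⟩

theorem CrossingDiagonals.swap_right {p : V × V} {z w : V} (h : CrossingDiagonals G p (z, w)) :
    CrossingDiagonals G p (w, z) :=
  ⟨h.1, h.2.1.symm, h.2.2.2.1, h.2.2.1, h.2.2.2.2.2, h.2.2.2.2.1⟩

theorem CrossingDiagonals.swap_left {p : V × V} {z w : V} (h : CrossingDiagonals G (z, w) p) :
    CrossingDiagonals G (w, z) p :=
  h.symm.swap_right.symm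

theorem DiagonalReachable.symm {p q : V × V} (h : DiagonalReachable G p q) :
    DiagonalReachable G q p :=
  have : Std.Symm (CrossingDiagonals G) := ⟨fun _ _ => CrossingDiagonals.symm⟩
  Relation.ReflTransGen.stdSymm.symm _ _ h

/-- A diagonal connected with a full diagonal is full. -/
theorem IsFullDiagonal.of_reachable {p q : V × V} (hp : IsFullDiagonal G p)
    (h : DiagonalReachable G p q) : IsFullDiagonal G q := by
  refine ⟨?_, fun v => ?_⟩
  · rcases Relation.ReflTransGen.cases_tail h with rfl | ⟨r, -, hr⟩
    exacts [hp.1, ⟨r, hr.symm⟩]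
  · obtain ⟨w, hw⟩ := hp.2 v
    exact ⟨w, (DiagonalReachable.symm h).trans hw⟩

/-- The only non-adjacent pairs in an induced square are its two diagonals, which cross; crossing
twice reverses the order of a pair. -/
theorem IsInducedFourCycle.reachable {s : Set V} (hs : IsInducedFourCycle G s) {x y x' y' : V}
    (hx : x ∈ s) (hy : y ∈ s) (hxy : x ≠ y) (hnxy : ¬ G.Adj x y) (hx' : x' ∈ s) (hy' : y' ∈ s)
    (hxy' : x' ≠ y') (hnxy' : ¬ G.Adj x' y') : DiagonalReachable G (x, y) (x', y') := by
  obtain ⟨a, b, c, d, rfl, hac, hbd, hab, hbc, hcd, hda, -, -⟩ := hs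
  have h1 : CrossingDiagonals G (a, c) (b, d) := ⟨hac, hbd, hab, hda.symm, hbc.symm, hcd⟩
  have diag {x y : V} (hx : x ∈ ({a, b, c, d} : Set V)) (hy : y ∈ ({a, b, c, d} : Set V))
      (hxy : x ≠ y) (hnxy : ¬ G.Adj x y) : DiagonalReachable G (a, c) (x, y) := by
    rcases hx with rfl | rfl | rfl | rfl <;> rcases hy with rfl | rfl | rfl | rfl <;>
      first
      | exact absurd rfl hxy
      | exact absurd ‹_› hnxy
      | exact absurd (SimpleGraph.Adj.symm ‹_›) hnxy
      | exact Relation.ReflTransGen.refl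
      | exact .single h1
      | exact .single h1.swap_right
      | exact (Relation.ReflTransGen.single h1).tail h1.symm.swap_right
  exact (DiagonalReachable.symm (diag hx hy hxy hnxy)).trans (diag hx' hy' hxy' hnxy')

theorem IsInducedFourCycle.exists_opposite {s : Set V} (hs : IsInducedFourCycle G s) {x : V}
    (hx : x ∈ s) : ∃ y ∈ s, x ≠ y ∧ ¬ G.Adj x y ∧ ∃ q, CrossingDiagonals G (x, y) q := by
  obtain ⟨a, b, c, d, rfl, hac, hbd, hab, hbc, hcd, hda, hnac, hnbd⟩ := hs
  have h1 : CrossingDiagonals G (a, c) (b, d) := ⟨hac, hbd, hab, hda.symm, hbc.symm, hcd⟩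
  rcases hx with rfl | rfl | rfl | rfl
  · exact ⟨c, by simp, hac, hnac, _, h1⟩
  · exact ⟨d, by simp, hbd, hnbd, _, h1.symm⟩
  · exact ⟨a, by simp, hac.symm, fun h => hnac h.symm, _, h1.swap_left⟩
  · exact ⟨b, by simp, hbd.symm, fun h => hnbd h.symm, _, h1.symm.swap_left⟩

theorem reachable_of_fourCycleGraph_reachable
    {s t : {s : Set V // IsInducedFourCycle G s}} (h : (fourCycleGraph G).Reachable s t)
    {x y x' y' : V} (hx : x ∈ s.1) (hy : y ∈ s.1) (hxy : x ≠ y) (hnxy : ¬ G.Adj x y)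
    (hx' : x' ∈ t.1) (hy' : y' ∈ t.1) (hxy' : x' ≠ y') (hnxy' : ¬ G.Adj x' y') :
    DiagonalReachable G (x, y) (x', y') := by
  obtain ⟨w⟩ := h
  induction w generalizing x y with
  | nil => exact IsInducedFourCycle.reachable (Subtype.property _) hx hy hxy hnxy hx' hy' hxy' hnxy'
  | cons hadj _ ih =>
    obtain ⟨-, a, b, hab, hnab, has, hbs, hat, hbt⟩ := hadj
    exact (IsInducedFourCycle.reachable (Subtype.property _) hx hy hxy hnxy has hbs hab hnab).trans
      (ih hat hbt hab hnab hx' hy')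

theorem HasFullFourCycleComponent.exists_isFullDiagonal [Nonempty V]
    (h : HasFullFourCycleComponent G) : ∃ p, IsFullDiagonal G p := by
  obtain ⟨c, hc⟩ := h
  have hcov (v : V) : ∃ s ∈ c.supp, v ∈ s.1 := by
    have := Set.mem_univ v
    rwa [← hc] at this
  obtain ⟨s, hs, hvs⟩ := hcov (Classical.arbitrary V)
  obtain ⟨y, hy, hxy, hnxy, hq⟩ := s.2.exists_opposite hvs
  refine ⟨(_, y), hq, fun v => ?_⟩
  obtain ⟨t, ht, hvt⟩ := hcov v
  obtain ⟨w, hw, hvw, hnvw, -⟩ := t.2.exists_opposite hvt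
  exact ⟨w, reachable_of_fourCycleGraph_reachable
    (SimpleGraph.ConnectedComponent.exact (hs.trans ht.symm)) hvs hy hxy hnxy hvt hw hvw hnvw⟩

/-- In a triangle-free `𝒞ℱ𝒮` graph the clique factor is empty, so some diagonal is full. -/
theorem IsCFS.exists_isFullDiagonal (hG : G.CliqueFree 3) (h : IsCFS G) :
    ∃ p, IsFullDiagonal G p := by
  obtain ⟨A, K, -, hAK, hadj, hA, -, hfull⟩ := h
  have := hA.to_subtype
  obtain ⟨p, ⟨q, hpq⟩, hp⟩ := hfull.exists_isFullDiagonal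
  have hmap {p q : A × A} (h : CrossingDiagonals (G.induce A) p q) :
      CrossingDiagonals G (Prod.map Subtype.val Subtype.val p)
        (Prod.map Subtype.val Subtype.val q) :=
    ⟨Subtype.coe_injective.ne h.1, Subtype.coe_injective.ne h.2.1, h.2.2⟩
  refine ⟨_, ⟨_, hmap hpq⟩, fun v => ?_⟩
  -- A vertex of `K` would form a triangle with the adjacent vertices `p.1` and `q.1`.
  have hv : v ∈ A := by
    by_contra hv
    have hvK : v ∈ K := ((Set.ext_iff.1 hAK v).2 trivial).resolve_left hv
    exact not_adj_of_triangleFree hG (hadj _ p.1.2 v hvK) (hadj _ q.1.2 v hvK) hpq.2.2.1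
  obtain ⟨w, hw⟩ := hp ⟨v, hv⟩
  exact ⟨w, Relation.ReflTransGen.lift (Prod.map Subtype.val Subtype.val) (fun _ _ => hmap) _ _ hw⟩

/-! ### Cutting along a square. -/

/-- Let `A` be a set of vertices that contains the square with diagonals `{x, y}` and `{m, n}`,
such that this square separates the rest of `A` from the complement of `A`. -/
theorem IsFullDiagonal.induce (hG : G.CliqueFree 3) {x y m n : V}
    (hfull : IsFullDiagonal G (x, y)) (hsq : CrossingDiagonals G (x, y) (m, n))
    {A : Set V} (hA : ({x, y, m, n} : Set V) ⊆ A)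
    (hsep : ∀ u ∈ A, u ∉ ({x, y, m, n} : Set V) → ∀ v, v ∉ A → ¬ G.Adj u v)
    (hN : ∀ u ∈ A, u ∉ ({x, y, m, n} : Set V) → ∀ v, v ∉ A →
      ¬ (G.Adj u x ∧ G.Adj u y ∧ G.Adj v x ∧ G.Adj v y)) :
    ∃ p, IsFullDiagonal (G.induce A) p := by
  have hx : x ∈ A := hA (by simp)
  have hy : y ∈ A := hA (by simp)
  have hm : m ∈ A := hA (by simp)
  have hn : n ∈ A := hA (by simp)
  obtain ⟨hxy, hmn, hxm, hxn, hym, hyn⟩ := id hsq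
  simp only at hxy hmn hxm hxn hym hyn
  let X : A × A := (⟨x, hx⟩, ⟨y, hy⟩)
  have lift {a b c d : V} (ha : a ∈ A) (hb : b ∈ A) (hc : c ∈ A) (hd : d ∈ A)
      (h : CrossingDiagonals G (a, b) (c, d)) :
      CrossingDiagonals (G.induce A) (⟨a, ha⟩, ⟨b, hb⟩) (⟨c, hc⟩, ⟨d, hd⟩) :=
    ⟨fun h' => h.1 (congrArg Subtype.val h'), fun h' => h.2.1 (congrArg Subtype.val h'), h.2.2⟩
  have rmn : DiagonalReachable (G.induce A) X (⟨m, hm⟩, ⟨n, hn⟩) := .single (lift hx hy hm hn hsq)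
  have rnm : DiagonalReachable (G.induce A) X (⟨n, hn⟩, ⟨m, hm⟩) :=
    .single (lift hx hy hn hm hsq.swap_right)
  have ryx : DiagonalReachable (G.induce A) X (⟨y, hy⟩, ⟨x, hx⟩) :=
    rmn.tail (lift hm hn hy hx hsq.symm.swap_right)
  have cases {a b c : V} (ha : a ∈ ({x, y, m, n} : Set V)) (hb : b ∈ ({x, y, m, n} : Set V))
      (hab : a ≠ b) (hac : G.Adj a c) (hbc : G.Adj b c) :
      (a = x ∧ b = y ∨ a = y ∧ b = x) ∨ (a = m ∧ b = n ∨ a = n ∧ b = m) := by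
    have h := not_adj_of_triangleFree hG hac hbc
    rcases ha with rfl | rfl | rfl | rfl <;> rcases hb with rfl | rfl | rfl | rfl <;>
      first
      | exact absurd rfl hab
      | exact absurd ‹_› h
      | exact absurd (SimpleGraph.Adj.symm ‹_›) h
      | simp
  have square {a b c : V} (ha : a ∈ ({x, y, m, n} : Set V)) (hb : b ∈ ({x, y, m, n} : Set V))
      (hab : a ≠ b) (hac : G.Adj a c) (hbc : G.Adj b c) :
      DiagonalReachable (G.induce A) X (⟨a, hA ha⟩, ⟨b, hA hb⟩) := by
    rcases cases ha hb hab hac hbc with (⟨rfl, rfl⟩ | ⟨rfl, rfl⟩) | (⟨rfl, rfl⟩ | ⟨rfl, rfl⟩)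
    exacts [.refl, ryx, rmn, rnm]
  have inSquare {a c : V} (ha : a ∈ A) (hc : c ∉ A) (hac : G.Adj a c) :
      a ∈ ({x, y, m, n} : Set V) := by
    by_contra h
    exact hsep a ha h c hc hac
  -- A sequence of diagonals that leaves `A` can only return through a diagonal of the square: a
  -- pair inside `A` crossing a pair with an endpoint outside consists of two non-adjacent square
  -- vertices. Both diagonals of the square are reachable within `A`, so the excursion can be
  -- dropped.
  have reach (p : V × V) (hp : DiagonalReachable G (x, y) p) (h1 : p.1 ∈ A) (h2 : p.2 ∈ A) :
      DiagonalReachable (G.induce A) X (⟨p.1, h1⟩, ⟨p.2, h2⟩) := by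
    induction hp with
    | refl => exact .refl
    | @tail p q _ hpq ih =>
      by_cases hp1 : p.1 ∈ A
      · by_cases hp2 : p.2 ∈ A
        · exact (ih hp1 hp2).tail (lift hp1 hp2 h1 h2 hpq)
        · exact square (inSquare h1 hp2 hpq.2.2.2.2.1.symm) (inSquare h2 hp2 hpq.2.2.2.2.2.symm)
            hpq.2.1 hpq.2.2.2.2.1.symm hpq.2.2.2.2.2.symm
      · exact square (inSquare h1 hp1 hpq.2.2.1.symm) (inSquare h2 hp1 hpq.2.2.2.1.symm)
            hpq.2.1 hpq.2.2.1.symm hpq.2.2.2.1.symm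
  refine ⟨X, ⟨_, lift hx hy hm hn hsq⟩, fun ⟨v, hv⟩ => ?_⟩
  by_cases hvQ : v ∈ ({x, y, m, n} : Set V)
  · rcases hvQ with rfl | rfl | rfl | rfl
    exacts [⟨_, .refl⟩, ⟨_, ryx⟩, ⟨_, rmn⟩, ⟨_, rnm⟩]
  obtain ⟨w, hw⟩ := hfull.2 v
  by_cases hwA : w ∈ A
  · exact ⟨⟨w, hwA⟩, reach _ hw hv hwA⟩
  -- If the partner `w` lies outside `A`, a diagonal crossing `{v, w}` must be a diagonal of the
  -- square. The hypothesis `hN` excludes `{x, y}`, so it is `{m, n}`, and `x` can replace `w` as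
  -- partner of `v`.
  obtain ⟨⟨a, b⟩, hvw, hab, hva, hvb, hwa, hwb⟩ := (hfull.of_reachable hw).1
  simp only at hvw hab hva hvb hwa hwb
  have haA : a ∈ A := by
    by_contra h
    exact hsep v hv hvQ a h hva
  have hbA : b ∈ A := by
    by_contra h
    exact hsep v hv hvQ b h hvb
  have hadj : G.Adj m v ∧ G.Adj n v := by
    rcases cases (inSquare haA hwA hwa.symm) (inSquare hbA hwA hwb.symm) hab hwa.symm hwb.symm
      with (⟨rfl, rfl⟩ | ⟨rfl, rfl⟩) | (⟨rfl, rfl⟩ | ⟨rfl, rfl⟩)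
    · exact absurd ⟨hva, hvb, hwa, hwb⟩ (hN v hv hvQ w hwA)
    · exact absurd ⟨hvb, hva, hwb, hwa⟩ (hN v hv hvQ w hwA)
    · exact ⟨hva.symm, hvb.symm⟩
    · exact ⟨hvb.symm, hva.symm⟩
  exact ⟨⟨x, hx⟩, rmn.tail (lift hm hn hv hx
    ⟨hmn, fun h => hvQ (by simp [show v = x from h]), hadj.1, hxm.symm, hadj.2, hxn.symm⟩)⟩

/-- In a triangle-free graph, the vertices `x`, `y` and any set of at least two common neighbours of
them span a non-trivial join. -/
theorem isNontrivialJoin_induce (hG : G.CliqueFree 3) {x y m n : V}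
    (hsq : CrossingDiagonals G (x, y) (m, n)) {M : Set V} (hm : m ∈ M) (hn : n ∈ M)
    (hMx : ∀ v ∈ M, G.Adj x v) (hMy : ∀ v ∈ M, G.Adj y v) {W : Set V} (hW : W = {x, y} ∪ M) :
    IsNontrivialJoin (G.induce W) := by
  obtain ⟨hxy, hmn, hxm, hxn, hym, hyn⟩ := id hsq
  simp only at hxy hmn hxm hxn hym hyn
  have hxW : x ∈ W := by simp [hW]
  have hyW : y ∈ W := by simp [hW]
  have hmW : m ∈ W := by simp [hW, hm]
  have hnW : n ∈ W := by simp [hW, hn]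
  refine ⟨{v | v.1 = x ∨ v.1 = y}, {v | v.1 ∈ M}, ?_, ?_, ?_, ?_, ?_⟩
  · refine Set.disjoint_left.2 ?_
    rintro v (h | h) hv
    exacts [(hMx _ hv).ne h.symm, (hMy _ hv).ne h.symm]
  · refine Set.eq_univ_of_forall fun ⟨v, hv⟩ => ?_
    rw [hW] at hv
    exact hv
  · rintro a (h | h) b hb <;> rw [SimpleGraph.comap_adj, Function.Embedding.subtype_apply, h]
    exacts [hMx b hb, hMy b hb]
  · intro h
    exact not_adj_of_triangleFree hG hxm hym
      (h (x := ⟨x, hxW⟩) (Or.inl rfl) (y := ⟨y, hyW⟩) (Or.inr rfl)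
        fun h => hxy (congrArg Subtype.val h))
  · intro h
    exact not_adj_of_triangleFree hG hxm.symm hxn.symm
      (h (x := ⟨m, hmW⟩) hm (y := ⟨n, hnW⟩) hn fun h => hmn (congrArg Subtype.val h))

theorem isNontrivialJoin_of_induce_univ (h : IsNontrivialJoin (G.induce Set.univ)) :
    IsNontrivialJoin G := by
  obtain ⟨A, B, hd, hu, hadj, hA, hB⟩ := h
  refine ⟨{v | ⟨v, trivial⟩ ∈ A}, {v | ⟨v, trivial⟩ ∈ B}, ?_, ?_, ?_, ?_, ?_⟩
  · exact Set.disjoint_left.2 fun v ha hb => Set.disjoint_left.1 hd ha hb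
  · exact Set.eq_univ_of_forall fun v => (Set.ext_iff.1 hu ⟨v, trivial⟩).2 trivial
  · exact fun a ha b hb => hadj _ ha _ hb
  · exact fun h => hA fun a ha b hb hab => h ha hb fun h' => hab (Subtype.ext h')
  · exact fun h => hB fun a ha b hb hab => h ha hb fun h' => hab (Subtype.ext h')

end

/-! ### Gluing and the induction on the number of vertices. -/

/-- Gluing of two induced subgraphs along a non-trivial join. -/
theorem CliqueSquareDecomposable.glue {V : Type u} {G : SimpleGraph V} {A B : Set V}
    (hAB : A ∪ B = Set.univ) (hsep : ∀ u ∈ A, u ∉ B → ∀ v ∈ B, v ∉ A → ¬ G.Adj u v)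
    (hA : CliqueSquareDecomposable (G.induce A)) (hB : CliqueSquareDecomposable (G.induce B))
    (hJ : IsNontrivialJoin (G.induce (A ∩ B))) : CliqueSquareDecomposable G := by
  rw [SimpleGraph.induce_eq_coe_induce_top] at hA hB
  refine .union G _ _ ?_ hA hB ?_ (Or.inr (Or.inr ⟨A ∩ B, subset_rfl, hJ⟩))
  · ext u v
    · simpa using (Set.ext_iff.1 hAB u)
    · simp only [SimpleGraph.Subgraph.sup_adj, SimpleGraph.Subgraph.induce_adj,
        SimpleGraph.Subgraph.top_adj]
      refine ⟨fun h => h.elim (·.2.2) (·.2.2), fun h => ?_⟩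
      have hu : u ∈ A ∨ u ∈ B := (Set.ext_iff.1 hAB u).2 trivial
      have hv : v ∈ A ∨ v ∈ B := (Set.ext_iff.1 hAB v).2 trivial
      have h1 := hsep u
      have h2 := hsep v
      have h' := h.symm
      tauto
  · intro u hu v hv h
    exact ⟨⟨hu.1, hv.1, h⟩, ⟨hu.2, hv.2, h⟩⟩

theorem cliqueSquareDecomposable_of_isFullDiagonal (k : ℕ) :
    ∀ {V : Type u} (G : SimpleGraph V) [Finite V], Nat.card V ≤ k → G.CliqueFree 3 →
      IsPlanar G → (∃ p, IsFullDiagonal G p) → CliqueSquareDecomposable G := by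
  induction k with
  | zero =>
    intro V G _ hcard _ _ ⟨p, _⟩
    have : Nonempty V := ⟨p.1⟩
    exact absurd (Nat.card_pos (α := V)) (by omega)
  | succ k ih =>
    intro V G _ hcard hG hplanar ⟨p, hp⟩
    have step {A : Set V} {v : V} (hv : v ∉ A) (hA : ∃ p, IsFullDiagonal (G.induce A) p) :
        CliqueSquareDecomposable (G.induce A) := by
      refine ih _ ?_ (hG.comap ⟨(SimpleGraph.Embedding.induce A).toCopy⟩)
        (hplanar.of_embedding (SimpleGraph.Embedding.induce A)) hA
      have := Set.ncard_lt_card (s := A) fun h => hv (h ▸ trivial)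
      rw [Nat.card_coe_set_eq]
      omega
    have whole {x y m n : V} (hsq : CrossingDiagonals G (x, y) (m, n)) {M : Set V} (hm : m ∈ M)
        (hn : n ∈ M) (hMx : ∀ v ∈ M, G.Adj x v) (hMy : ∀ v ∈ M, G.Adj y v)
        (hW : ∀ v, v ∈ ({x, y} : Set V) ∪ M) : CliqueSquareDecomposable G :=
      .join G ‹_› (isNontrivialJoin_of_induce_univ (isNontrivialJoin_induce hG hsq hm hn hMx hMy
        (Set.eq_univ_of_forall hW).symm))
    by_cases hbig : ∃ q : V × V, DiagonalReachable G p q ∧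
        2 < {v | G.Adj q.1 v ∧ G.Adj q.2 v}.ncard
    · obtain ⟨⟨x, y⟩, hq, hcard3⟩ := hbig
      have hfull := hp.of_reachable hq
      obtain ⟨⟨m₀, n₀⟩, hsq₀⟩ := hfull.1
      have hxy : x ≠ y := hsq₀.1
      simp only at hcard3
      set N : Set V := {v | G.Adj x v ∧ G.Adj y v}
      by_cases hJ : ∀ v, v ∈ ({x, y} : Set V) ∪ N
      · exact whole hsq₀ (M := N) ⟨hsq₀.2.2.1, hsq₀.2.2.2.2.1⟩ ⟨hsq₀.2.2.2.1, hsq₀.2.2.2.2.2⟩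
          (fun v hv => hv.1) (fun v hv => hv.2) hJ
      push Not at hJ
      obtain ⟨c, hc⟩ := hJ
      -- The component of `c` after deletion of `{x, y} ∪ N`.
      let C : Set V :=
        {v | Relation.ReflTransGen (fun a b => G.Adj a b ∧ b ∉ ({x, y} : Set V) ∪ N) c v}
      have hCJ {v} (hv : v ∈ C) : v ∉ ({x, y} : Set V) ∪ N := by
        rcases Relation.ReflTransGen.cases_tail hv with rfl | ⟨w, -, hw⟩
        exacts [hc, hw.2]
      have hCx : x ∉ C := fun h => hCJ h (by simp)
      have hCy : y ∉ C := fun h => hCJ h (by simp)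
      have hCN {v} (hv : v ∈ N) : v ∉ C := fun h => hCJ h (Or.inr hv)
      have hconn : ∀ v ∈ C,
          Relation.ReflTransGen (fun a b => G.Adj a b ∧ a ∈ C ∧ b ∈ C) c v := by
        intro v hv
        induction hv with
        | refl => exact .refl
        | tail h h' ih => exact ih.tail ⟨h'.1, h, h.tail h'⟩
      have hT : {v ∈ N | ∃ u ∈ C, G.Adj u v}.ncard ≤ 2 := by
        by_contra! h
        obtain ⟨a, b, d, ha, hb, hd, hab, had, hbd⟩ := (Set.two_lt_ncard_iff).1 h
        have hall (P : V → Prop) (h1 : P a) (h2 : P b) (h3 : P d) (j : Fin 3) :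
            P (![a, b, d] j) := by
          fin_cases j <;> assumption
        refine hplanar.not_attached hxy (n := ![a, b, d]) ?_ (hall _ ha.1.1 hb.1.1 hd.1.1)
          (hall _ ha.1.2 hb.1.2 hd.1.2) hconn hCx hCy
          (hall (· ∉ C) (hCN ha.1) (hCN hb.1) (hCN hd.1))
          (hall (fun n => ∃ v ∈ C, G.Adj v n) ha.2 hb.2 hd.2)
        intro i j hij
        fin_cases i <;> fin_cases j <;>
          first
          | rfl
          | exact absurd hij ‹_›
          | exact absurd hij.symm ‹_›
      -- The attaching vertices in `N` are enlarged to exactly two, the second diagonal of the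
      -- cutting square. A further `l ∈ N` remains outside `C ∪ Q`, which makes that side proper;
      -- `c` does this for the other side.
      obtain ⟨S, hTS, hSN, hS⟩ := Set.exists_subsuperset_card_eq (Set.sep_subset _ _) hT hcard3.le
      obtain ⟨l, hlN, hlS⟩ := Set.exists_mem_notMem_of_ncard_lt_ncard (s := S) (t := N)
        (by omega)
      obtain ⟨m, n, hmn, rfl⟩ := Set.ncard_eq_two.1 hS
      have hm : m ∈ N := hSN (by simp)
      have hn : n ∈ N := hSN (by simp)
      have hsq : CrossingDiagonals G (x, y) (m, n) := ⟨hxy, hmn, hm.1, hn.1, hm.2, hn.2⟩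
      let Q : Set V := {x, y, m, n}
      have hQC {v} (hv : v ∈ Q) : v ∉ C := by
        rcases hv with rfl | rfl | rfl | rfl
        exacts [hCx, hCy, hCN hm, hCN hn]
      have hsep : ∀ u ∈ C, ∀ v, v ∉ C ∪ Q → ¬ G.Adj u v := by
        intro u hu v hv huv
        refine hv ?_
        by_cases hvJ : v ∈ ({x, y} : Set V) ∪ N
        · rcases hvJ with (rfl | rfl) | hvN
          · exact Or.inr (by simp [Q])
          · exact Or.inr (by simp [Q])
          · exact Or.inr (Or.inr (Or.inr (hTS ⟨hvN, u, hu, huv⟩)))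
        · exact Or.inl (Relation.ReflTransGen.tail hu ⟨huv, hvJ⟩)
      have hNC {v} (hv : v ∈ C) (h : G.Adj v x ∧ G.Adj v y) : False :=
        hCN (v := v) ⟨h.1.symm, h.2.symm⟩ hv
      have hl : l ∉ C ∪ Q := by
        rintro (h | rfl | rfl | h)
        exacts [hCN hlN h, G.irrefl hlN.1, G.irrefl hlN.2, hlS h]
      have hQ : (C ∪ Q) ∩ Cᶜ = Q := by
        ext v
        refine ⟨fun h => h.1.resolve_left h.2, fun h => ⟨Or.inr h, hQC h⟩⟩
      have hA : CliqueSquareDecomposable (G.induce (C ∪ Q)) := by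
        refine step hl (hfull.induce hG hsq Set.subset_union_right ?_ ?_)
        · exact fun u hu huQ v hv => hsep u (hu.resolve_right huQ) v hv
        · exact fun u hu huQ v _ h => hNC (hu.resolve_right huQ) ⟨h.1, h.2.1⟩
      have hB : CliqueSquareDecomposable (G.induce Cᶜ) := by
        refine step (v := c) (fun h => h .refl) (hfull.induce hG hsq (fun v => hQC) ?_ ?_)
        · exact fun u hu huQ v hv h =>
            hsep v (not_not.1 hv) u (fun h' => h'.elim hu huQ) h.symm
        · exact fun u _ _ v hv h => hNC (not_not.1 hv) h.2.2
      refine .glue ?_ ?_ hA hB ?_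
      · refine Set.eq_univ_of_forall fun v => ?_
        by_cases hv : v ∈ C
        exacts [Or.inl (Or.inl hv), Or.inr hv]
      · exact fun u _ hu v _ hv => hsep u (not_not.1 hu) v hv
      · rw [hQ]
        refine isNontrivialJoin_induce hG hsq (M := {m, n}) (by simp) (by simp) ?_ ?_ ?_
        · rintro v (rfl | rfl)
          exacts [hm.1, hn.1]
        · rintro v (rfl | rfl)
          exacts [hm.2, hn.2]
        · ext v
          simp only [Q, Set.mem_insert_iff, Set.mem_singleton_iff, Set.mem_union]
          tauto
    · push Not at hbig
      obtain ⟨x, y⟩ := p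
      obtain ⟨⟨⟨m, n⟩, hsq⟩, hcov⟩ := hp
      -- Here every reachable diagonal has at most two common neighbours, so these are the ends of
      -- any diagonal crossing it.
      have unique {a b c d : V} (h : DiagonalReachable G (x, y) (a, b))
          (hcd : CrossingDiagonals G (a, b) (c, d)) (v : V) (hva : G.Adj a v) (hvb : G.Adj b v) :
          v = c ∨ v = d := by
        have hsub : ({c, d} : Set V) ⊆ {v | G.Adj a v ∧ G.Adj b v} := by
          rintro v (rfl | rfl)
          exacts [⟨hcd.2.2.1, hcd.2.2.2.2.1⟩, ⟨hcd.2.2.2.1, hcd.2.2.2.2.2⟩]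
        have heq := Set.eq_of_subset_of_ncard_le hsub
          (by rw [Set.ncard_pair hcd.2.1]; exact hbig _ h)
        exact (Set.ext_iff.1 heq v).2 ⟨hva, hvb⟩
      have hmnr : DiagonalReachable G (x, y) (m, n) := .single hsq
      have hreach : ∀ q, DiagonalReachable G (x, y) q →
          ((q.1 = x ∨ q.1 = y) ∧ (q.2 = x ∨ q.2 = y)) ∨
            ((q.1 = m ∨ q.1 = n) ∧ (q.2 = m ∨ q.2 = n)) := by
        intro q hq
        induction hq with
        | refl => simp
        | @tail q r _ hqr ih =>
          obtain ⟨q₁, q₂⟩ := q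
          obtain ⟨r₁, r₂⟩ := r
          obtain ⟨hq, -, h11, h12, h21, h22⟩ := hqr
          simp only at ih hq h11 h12 h21 h22 ⊢
          rcases ih with h | h
          · right
            have hadj : ∀ r, G.Adj q₁ r → G.Adj q₂ r → G.Adj x r ∧ G.Adj y r := by
              rcases h with ⟨rfl | rfl, rfl | rfl⟩
              exacts [absurd rfl hq, fun r h1 h2 => ⟨h1, h2⟩, fun r h1 h2 => ⟨h2, h1⟩,
                absurd rfl hq]
            exact ⟨unique .refl hsq _ (hadj _ h11 h21).1 (hadj _ h11 h21).2,
              unique .refl hsq _ (hadj _ h12 h22).1 (hadj _ h12 h22).2⟩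
          · left
            have hadj : ∀ r, G.Adj q₁ r → G.Adj q₂ r → G.Adj m r ∧ G.Adj n r := by
              rcases h with ⟨rfl | rfl, rfl | rfl⟩
              exacts [absurd rfl hq, fun r h1 h2 => ⟨h1, h2⟩, fun r h1 h2 => ⟨h2, h1⟩,
                absurd rfl hq]
            exact ⟨unique hmnr hsq.symm _ (hadj _ h11 h21).1 (hadj _ h11 h21).2,
              unique hmnr hsq.symm _ (hadj _ h12 h22).1 (hadj _ h12 h22).2⟩
      refine whole hsq (M := {m, n}) (by simp) (by simp) ?_ ?_ fun v => ?_
      · rintro v (rfl | rfl)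
        exacts [hsq.2.2.1, hsq.2.2.2.1]
      · rintro v (rfl | rfl)
        exacts [hsq.2.2.2.2.1, hsq.2.2.2.2.2]
      · obtain ⟨w, hw⟩ := hcov v
        rcases hreach _ hw with h | h
        exacts [Or.inl h.1, Or.inr h.1]

end RACGraph

theorem mainTheorem12 {V : Type*} (G : SimpleGraph V) (hG : RACGraph.IsCFSZero G) :
    RACGraph.CliqueSquareDecomposable G := by
  have := hG.finite
  exact RACGraph.cliqueSquareDecomposable_of_isFullDiagonal _ G le_rfl hG.triangleFree hG.planar
    (hG.cfs.exists_isFullDiagonal hG.triangleFree)
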